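/- Let $d\ge 2$ and let $\boldsymbol\sigma=(\sigma_1,\ldots,\sigma_d)'$ be a permutation of $1,\ldots,d$. A vine decomposition in dimension $d$ is given by a regular vine on $\{1,\ldots,d\}$: a sequence of trees $T_1,\ldots,T_{d-1}$ such that $T_1$ has node set $\{1,\ldots,d\}$, the node set of $T_{k+1}$ is the edge set of $T_k$, and two edges of $T_k$ that are joined by an edge of $T_{k+1}$ share a node. An edge $e=\{a,b\}$ stands for the pair-copula with set of conditioned variables $A\,\triangle\,B$ and set of conditioning variables $A\cap B$, where $A,B\subseteq\{1,\ldots,d\}$ are the sets of all variables occurring in $a$ and $b$, respectively. A lower-triangular matrix $M=(m_{i,j})_{i,j=1}^d$ ($m_{i,j}=0$ for $i<j$, and $m_{i,j}\in\{1,\ldots,d\}$ for $i\ge j$) is a vine structure matrix if 1. $\{m_{j,j},\ldots,m_{d,j}\}\subseteq\{m_{i,i},\ldots,m_{d,i}\}$ for $1\le i<j\le d$; 2. $m_{i,i}\notin\{m_{i+1,i+1},\ldots,m_{d,i+1}\}$ for $i=1,\ldots,d-1$; 3. for $i=1,\ldots,d-2$ and $k=i+1,\ldots,d$ there is a $j>i$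 such that either $m_{k,i}=m_{j,j}$ and $\{m_{k+1,i},\ldots,m_{d,i}\}=\{m_{k+1,j},\ldots,m_{d,j}\}$, or $k<d$, $m_{k,i}=m_{k+1,j}$ and $\{m_{k+1,i},\ldots,m_{d,i}\}=\{m_{j,j},m_{k+2,j},\ldots,m_{d,j}\}$. Such an $M$ is a structure matrix of a vine decomposition if the pair-copulas of the decomposition are exactly those with conditioned variables $m_{k,j},m_{j,j}$ and conditioning variables $m_{k+1,j},\ldots,m_{d,j}$, for $1\le j<k\le d$. Then there are exactly $2^{\binom{d-2}{2}+d-2}$ different vine decompositions that have a structure matrix with diagonal $\boldsymbol\sigma$, i.e. with $m_{i,i}=\sigma_i$ for $i=1,\ldots,d$. -/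

import Mathlib

/-- Nodes of the trees of a vine on positive-integer variables: a node of the first tree is a
variable, and a node of each further tree is an unordered pair of nodes of the previous tree
(one of the edges of that tree). -/
def VineNode : ℕ → Type
  | 0 => ℕ
  | k + 1 => Sym2 (VineNode k)

/-- The complete union of a node: all variables that occur in it. -/
def VineNode.vars : (k : ℕ) → VineNode k → Finset ℕ
  | 0, v => {(show ℕ from v)}
  | k + 1, e =>
    Sym2.lift
      ⟨fun a b : VineNode k => VineNode.vars k a ∪ VineNode.vars k b,
        fun _ _ => Finset.union_comm _ _⟩
      (show Sym2 (VineNode k) from e)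

/-- The node sets belonging to a sequence of graphs on `d` variables: the first graph lives on
the variables `1, …, d`, each further graph on the edges of its predecessor. -/
def vineNodes (d : ℕ) (tree : (k : ℕ) → SimpleGraph (VineNode k)) : (k : ℕ) → Set (VineNode k)
  | 0 => {v | (show ℕ from v) ∈ Set.Icc 1 d}
  | k + 1 => (tree k).edgeSet

/-- A regular vine (Bedford and Cooke) on the variables `1, …, d`. The graph `tree k` is the
`(k + 1)`-st tree of the vine, for `k = 0, …, d - 2`. -/
structure RegularVine (d : ℕ) where
  tree : (k : ℕ) → SimpleGraph (VineNode k)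
  /-- Edges join nodes only. -/
  mem_nodes : ∀ k a b, (tree k).Adj a b → a ∈ vineNodes d tree k ∧ b ∈ vineNodes d tree k
  /-- Each of the `d - 1` graphs is a tree on its node set. -/
  isTree : ∀ k, k + 1 < d → ((tree k).induce (vineNodes d tree k)).IsTree
  /-- There are no further trees. -/
  tree_eq_bot : ∀ k, d ≤ k + 1 → tree k = ⊥
  /-- Proximity condition: two edges of a tree that are joined in the next tree share a node. -/
  proximity : ∀ (k : ℕ) (a b : Sym2 (VineNode k)),
    (tree (k + 1)).Adj a b → ∃ c : VineNode k, c ∈ a ∧ c ∈ b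

/-- The pair-copulas of the decomposition given by a regular vine: an edge `{a, b}` stands for
the pair-copula whose set of conditioned variables is the symmetric difference, and whose set of
conditioning variables is the intersection, of the complete unions of `a` and `b`. A pair-copula
is recorded as (set of conditioned variables, set of conditioning variables). -/
def RegularVine.pairCopulas {d : ℕ} (V : RegularVine d) : Set (Finset ℕ × Finset ℕ) :=
  {p | ∃ (k : ℕ) (a b : VineNode k), (V.tree k).Adj a b ∧
    p = (symmDiff (VineNode.vars k a) (VineNode.vars k b),
         VineNode.vars k a ∩ VineNode.vars k b)}

/-- The set of the entries of column `j` of `M` in row `k` and below. -/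
def colFrom {d : ℕ} (M : Matrix (Fin d) (Fin d) ℕ) (k j : Fin d) : Finset ℕ :=
  (Finset.Ici k).image fun r => M r j

/-- The set of the entries of column `j` of `M` strictly below row `k`. -/
def colBelow {d : ℕ} (M : Matrix (Fin d) (Fin d) ℕ) (k j : Fin d) : Finset ℕ :=
  (Finset.Ioi k).image fun r => M r j

/-- Vine structure matrices. Rows and columns are numbered from `0` here. -/
structure IsVineStructureMatrix {d : ℕ} (M : Matrix (Fin d) (Fin d) ℕ) : Prop where
  /-- The matrix is lower triangular. -/
  upper_eq_zero : ∀ i j, i < j → M i j = 0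
  /-- The entries on and below the diagonal are indices of variables. -/
  lower_mem : ∀ i j, j ≤ i → M i j ∈ Set.Icc 1 d
  /-- The entries of a column appear in every column to the left. -/
  col_subset : ∀ i j, i < j → colFrom M j j ⊆ colFrom M i i
  /-- A diagonal entry does not appear in the next column. -/
  diag_notMem : ∀ i j : Fin d, (j : ℕ) = i + 1 → M i i ∉ colFrom M j j
  /-- The last alternative concerns only rows `k` that have a next row `l`. -/
  exists_col : ∀ i k : Fin d, (i : ℕ) + 2 < d → i < k → ∃ j, i < j ∧
    ((M k i = M j j ∧ colBelow M k i = colBelow M k j) ∨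
      ∃ l : Fin d, (l : ℕ) = k + 1 ∧
        M k i = M l j ∧ colBelow M k i = insert (M j j) (colBelow M l j))

/-- The pair-copulas encoded by a matrix: the entry in row `k` and column `j`, below the
diagonal, stands for the pair-copula with conditioned variables `M k j`, `M j j` and with
conditioning variables the entries of column `j` below row `k`. -/
def matrixPairCopulas {d : ℕ} (M : Matrix (Fin d) (Fin d) ℕ) : Set (Finset ℕ × Finset ℕ) :=
  {p | ∃ j k : Fin d, j < k ∧ p = ({M k j, M j j}, colBelow M k j)}

/-- `M` is a structure matrix of the vine `V`. -/
def RegularVine.HasStructureMatrix {d : ℕ} (V : RegularVine d)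
    (M : Matrix (Fin d) (Fin d) ℕ) : Prop :=
  IsVineStructureMatrix M ∧ matrixPairCopulas M = V.pairCopulas

/-!
Write `s 0, …, s (d - 1)` for the diagonal `σ` read backwards. A column of a structure matrix is
then added to the later ones by adding a new variable `s n` to a vine on `s 0, …, s (n - 1)`, and
every set of variables `A` that occurs as a node of the vine is given by its size `r + 1` and its
largest index `n ≥ r`. So the nodes of level `r` may be numbered `r, …, d - 1`, and each node `n`
of level `r + 1` is the edge that joins the node `n` of level `r` to an earlier node `q r n`. Every
tree of the vine becomes a rooted tree with parent function `q r`, and the vine becomes an array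
`q` with `r ≤ q r n < n` for `r < n < d`. The proximity condition, as well as
`IsVineStructureMatrix.exists_col`, becomes `q r n ∈ {q (r + 1) n, q r (q (r + 1) n)}` (`IsParentArray`).

These two values are different, and `q (n - 1) n = n - 1` is forced. Hence there is one free binary
choice for each pair `r + 1 < n < d`, that is, for `(d - 1).choose 2 = (d - 2).choose 2 + (d - 2)`
pairs, and parent arrays correspond to sets of such pairs (`choiceArray`,
`mem_iff_choiceArray_eq`, `IsParentArray.exists_choiceArray`).

It remains to see that the vines with a structure matrix with diagonal `σ` are exactly the vines
`parentVine` of parent arrays. A parent array gives a regular vine, different ones for different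
arrays (`parentArray_eq_of_parentVine_eq`), and a structure matrix of it (`parentMatrix`).
Conversely, a structure matrix gives a parent array whose vine has the same pair-copulas
(`IsVineStructureMatrix.exists_parentArray`, `linked_of_parents`, `matrixPairCopulas_eq`), and no
other vine has these pair-copulas (`RegularVine.eq_parentVine`): level by level, each edge of such a
vine is an edge of `parentVine`, and a tree has no proper spanning subgraph that is a tree.
-/

/-! ### Parent arrays -/

/-- A parent array: the level `r` tree is the rooted tree on `r, …, d - 1` with root `r` in which
`q r n` is the parent of `n`. The last condition makes successive trees satisfy the proximity
condition, the node `n` of level `r + 1` being the edge from `n` to `q r n`. -/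
structure IsParentArray (d : ℕ) (q : ℕ → ℕ → ℕ) : Prop where
  le : ∀ r n, r < n → n < d → r ≤ q r n
  lt : ∀ r n, r < n → n < d → q r n < n
  prox : ∀ r n, r + 1 < n → n < d → q r n = q (r + 1) n ∨ q r n = q r (q (r + 1) n)

/-- The parent array belonging to a set `S` of binary choices: `(n, r) ∈ S` selects the first of
the two values that `IsParentArray.prox` leaves for `q r n`. -/
def choiceArray (S : Finset (Σ _ : ℕ, ℕ)) (r n : ℕ) : ℕ :=
  if r + 1 < n then
    if ⟨n, r⟩ ∈ S then choiceArray S (r + 1) n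
    else if choiceArray S (r + 1) n < n then choiceArray S r (choiceArray S (r + 1) n) else 0
  else n - 1
termination_by (n, n - r)

/-- The positions `(n, r)` at which a parent array has a choice. -/
def choicePositions (d : ℕ) : Finset (Σ _ : ℕ, ℕ) :=
  (Finset.range d).sigma fun n => Finset.range (n - 1)

lemma mem_choicePositions {d n r : ℕ} :
    (⟨n, r⟩ : Σ _ : ℕ, ℕ) ∈ choicePositions d ↔ r + 1 < n ∧ n < d := by
  simp only [choicePositions, Finset.mem_sigma, Finset.mem_range]
  omega

lemma card_choicePositions {d : ℕ} (hd : 2 ≤ d) :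
    (choicePositions d).card = (d - 2).choose 2 + (d - 2) := by
  obtain ⟨m, rfl⟩ := Nat.exists_eq_add_of_le' hd
  have h : ∀ m, ∑ n ∈ Finset.range (m + 2), (n - 1) = m.choose 2 + m := by
    intro m
    induction m with
    | zero => rfl
    | succ m ih =>
      rw [Finset.sum_range_succ, ih, Nat.choose_succ_succ' m 1, Nat.choose_one_right,
        show m + 2 - 1 = m + 1 by omega]
      ring
  simp only [choicePositions, Finset.card_sigma, Finset.card_range, h, Nat.add_sub_cancel]

lemma choiceArray_bounds (S : Finset (Σ _ : ℕ, ℕ)) (r n : ℕ) (h : r < n) :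
    r ≤ choiceArray S r n ∧ choiceArray S r n < n := by
  rw [choiceArray]
  split_ifs with h1 h2 h3
  · have := choiceArray_bounds S (r + 1) n h1
    omega
  · have h4 := choiceArray_bounds S (r + 1) n h1
    have h5 := choiceArray_bounds S r (choiceArray S (r + 1) n) (by omega)
    omega
  · exact absurd (choiceArray_bounds S (r + 1) n h1).2 h3
  · omega
termination_by (n, n - r)

lemma choiceArray_step (S : Finset (Σ _ : ℕ, ℕ)) (r n : ℕ) (h : r + 1 < n) :
    choiceArray S r n = if ⟨n, r⟩ ∈ S then choiceArray S (r + 1) n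
      else choiceArray S r (choiceArray S (r + 1) n) := by
  rw [choiceArray, if_pos h, if_pos (choiceArray_bounds S (r + 1) n h).2]

lemma mem_iff_choiceArray_eq (S : Finset (Σ _ : ℕ, ℕ)) (r n : ℕ) (h : r + 1 < n) :
    ⟨n, r⟩ ∈ S ↔ choiceArray S r n = choiceArray S (r + 1) n := by
  have h1 := choiceArray_bounds S (r + 1) n h
  have h2 := choiceArray_bounds S r (choiceArray S (r + 1) n) (by omega)
  rw [choiceArray_step S r n h]
  split_ifs with h3
  · simp [h3]
  · simp only [h3, false_iff]
    omega

lemma isParentArray_choiceArray (d : ℕ) (S : Finset (Σ _ : ℕ, ℕ)) :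
    IsParentArray d (choiceArray S) where
  le r n h _ := (choiceArray_bounds S r n h).1
  lt r n h _ := (choiceArray_bounds S r n h).2
  prox r n h _ := by
    rw [choiceArray_step S r n h]
    split_ifs
    · exact Or.inl rfl
    · exact Or.inr rfl

open Classical in
/-- Every parent array arises from binary choices. -/
lemma IsParentArray.exists_choiceArray {d : ℕ} {q : ℕ → ℕ → ℕ} (hq : IsParentArray d q) :
    ∃ S ⊆ choicePositions d, ∀ r n, r < n → n < d → choiceArray S r n = q r n := by
  set S : Finset (Σ _ : ℕ, ℕ) :=
    (choicePositions d).filter fun x => q x.2 x.1 = q (x.2 + 1) x.1 with hS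
  have key : ∀ n, n < d → ∀ t, t < n → choiceArray S (n - 1 - t) n = q (n - 1 - t) n := by
    intro n
    induction n using Nat.strong_induction_on with
    | _ n ihn =>
      intro hn t
      induction t with
      | zero =>
        intro h0
        have h1 := hq.le (n - 1) n (by omega) hn
        have h2 := hq.lt (n - 1) n (by omega) hn
        have h3 := choiceArray_bounds S (n - 1) n (by omega)
        simp only [Nat.sub_zero]
        omega
      | succ t iht =>
        intro ht
        obtain ⟨r, hr⟩ : ∃ r, n = r + t + 2 := ⟨n - (t + 2), by omega⟩
        have e1 : n - 1 - (t + 1) = r := by omega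
        have e2 : n - 1 - t = r + 1 := by omega
        have ih := iht (by omega)
        rw [e2] at ih
        rw [e1, choiceArray_step S r n (by omega), ih]
        have hmem : ⟨n, r⟩ ∈ S ↔ q r n = q (r + 1) n := by
          simp only [hS, Finset.mem_filter, mem_choicePositions]
          exact and_iff_right ⟨by omega, hn⟩
        split_ifs with h
        · exact (hmem.1 h).symm
        · have hle := hq.le (r + 1) n (by omega) hn
          have hlt := hq.lt (r + 1) n (by omega) hn
          have h4 := ihn _ hlt (by omega) (q (r + 1) n - 1 - r) (by omega)
          rw [show q (r + 1) n - 1 - (q (r + 1) n - 1 - r) = r by omega] at h4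
          rw [h4]
          exact ((hq.prox r n (by omega) hn).resolve_left fun h' => h (hmem.2 h')).symm
  refine ⟨S, Finset.filter_subset _ _, fun r n h hn => ?_⟩
  have := key n hn (n - 1 - r) (by omega)
  rwa [show n - 1 - (n - 1 - r) = r by omega] at this

/-! ### Label sets of the nodes -/

/-- The labels of the variables occurring in the node `n` of level `r`. -/
def labels (q : ℕ → ℕ → ℕ) : ℕ → ℕ → Finset ℕ
  | 0, n => {n}
  | r + 1, n => labels q r n ∪ labels q r (q r n)


lemma mem_labels_self (q : ℕ → ℕ → ℕ) (r n : ℕ) : n ∈ labels q r n := by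
  induction r with
  | zero => simp [labels]
  | succ r ih => exact Finset.mem_union_left _ ih

lemma IsParentArray.le_of_mem_labels {d : ℕ} {q : ℕ → ℕ → ℕ} (hq : IsParentArray d q)
    {r n x : ℕ} (hr : r ≤ n) (hn : n < d)
    (hx : x ∈ labels q r n) : x ≤ n := by
  induction r generalizing n with
  | zero => exact (Finset.mem_singleton.1 hx).le
  | succ r ih =>
    have hle := hq.le r n hr hn
    have hlt := hq.lt r n hr hn
    rcases Finset.mem_union.1 hx with h | h
    · exact ih (by omega) hn h
    · have := ih hle (by omega) h
      omega

/-- The larger of the two nodes that an edge joins contributes only its largest label; its other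
labels occur in the parent, by the proximity condition. -/
lemma IsParentArray.labels_succ {d : ℕ} {q : ℕ → ℕ → ℕ} (hq : IsParentArray d q)
    {r n : ℕ} (hr : r < n) (hn : n < d) :
    labels q (r + 1) n = insert n (labels q r (q r n)) := by
  induction r generalizing n with
  | zero => rfl
  | succ r ih =>
    have hle := hq.le (r + 1) n hr hn
    have hlt := hq.lt (r + 1) n hr hn
    have hsub : labels q r (q r n) ⊆ labels q (r + 1) (q (r + 1) n) := by
      rcases hq.prox r n hr hn with h | h
      · rw [h]
        exact Finset.subset_union_left
      · rw [h]
        exact Finset.subset_union_right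
    rw [labels, ih (by omega) hn, Finset.insert_union, Finset.union_eq_right.2 hsub]

lemma IsParentArray.notMem_labels_parent {d : ℕ} {q : ℕ → ℕ → ℕ} (hq : IsParentArray d q)
    {r n : ℕ} (hr : r < n) (hn : n < d) :
    n ∉ labels q r (q r n) := fun h => by
  have h1 := hq.lt r n hr hn
  have h2 := hq.le_of_mem_labels (hq.le r n hr hn) (by omega) h
  omega

lemma IsParentArray.card_labels {d : ℕ} {q : ℕ → ℕ → ℕ} (hq : IsParentArray d q)
    {r n : ℕ} (hr : r ≤ n) (hn : n < d) :
    (labels q r n).card = r + 1 := by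
  induction r generalizing n with
  | zero => rfl
  | succ r ih =>
    rw [hq.labels_succ hr hn, Finset.card_insert_of_notMem (hq.notMem_labels_parent hr hn),
      ih (hq.le r n hr hn) ((hq.lt r n hr hn).trans hn)]

/-- The node `n` of level `n` contains all of the first `n + 1` variables. -/
lemma IsParentArray.labels_diag {d : ℕ} {q : ℕ → ℕ → ℕ} (hq : IsParentArray d q)
    {n : ℕ} (hn : n < d) : labels q n n = Finset.range (n + 1) := by
  refine Finset.eq_of_subset_of_card_le (fun x hx => ?_) ?_
  · exact Finset.mem_range.2 (Nat.lt_succ_of_le (hq.le_of_mem_labels le_rfl hn hx))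
  · rw [hq.card_labels le_rfl hn, Finset.card_range]

/-! ### The regular vine of a parent array -/

/-- The node `n` of level `r` of the vine with parent array `q`, the variable with index `n`
being `s n`. -/
def parentNode (s : ℕ → ℕ) (q : ℕ → ℕ → ℕ) : (r : ℕ) → ℕ → VineNode r
  | 0, n => (show ℕ from s n)
  | r + 1, n => (s(parentNode s q r n, parentNode s q r (q r n)) : Sym2 (VineNode r))

lemma vars_parentNode (s : ℕ → ℕ) (q : ℕ → ℕ → ℕ) (r n : ℕ) :
    VineNode.vars r (parentNode s q r n) = (labels q r n).image s := by
  induction r generalizing n with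
  | zero => rfl
  | succ r ih =>
    change VineNode.vars r (parentNode s q r n) ∪ VineNode.vars r (parentNode s q r (q r n)) = _
    rw [ih, ih, labels, Finset.image_union]

/-- The tree on level `r` of the vine with parent array `q`. -/
def parentTree (d : ℕ) (s : ℕ → ℕ) (q : ℕ → ℕ → ℕ) (r : ℕ) : SimpleGraph (VineNode r) :=
  SimpleGraph.fromEdgeSet
    {e | ∃ n, r < n ∧ n < d ∧ e = s(parentNode s q r n, parentNode s q r (q r n))}

/-- The largest label of a node can be read off from the set of its variables. -/
lemma index_eq_of_image_labels_eq {d : ℕ} {s : ℕ → ℕ} {q q' : ℕ → ℕ → ℕ}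
    (hs : Set.InjOn s (Set.Iio d)) (hq : IsParentArray d q) (hq' : IsParentArray d q')
    {r r' n n' : ℕ} (hr : r ≤ n) (hn : n < d) (hr' : r' ≤ n') (hn' : n' < d)
    (h : (labels q r n).image s = (labels q' r' n').image s) : n = n' := by
  have key : ∀ {q q' : ℕ → ℕ → ℕ} (_ : IsParentArray d q') {r r' n n' : ℕ}
      (_ : n < d) (_ : r' ≤ n') (_ : n' < d)
      (_ : (labels q r n).image s = (labels q' r' n').image s), n ≤ n' := by
    intro q q' hq' r r' n n' hn hr' hn' h
    have h1 := Finset.mem_image_of_mem s (mem_labels_self q r n)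
    rw [h] at h1
    obtain ⟨x, hx, hxn⟩ := Finset.mem_image.1 h1
    have h2 := hq'.le_of_mem_labels hr' hn' hx
    have h3 : x = n := hs (Set.mem_Iio.2 (by omega)) hn hxn
    omega
  exact le_antisymm (key hq' hn hr' hn' h) (key hq hn' hr hn h.symm)

lemma index_eq_of_parentNode_eq {d : ℕ} {s : ℕ → ℕ} {q q' : ℕ → ℕ → ℕ}
    (hs : Set.InjOn s (Set.Iio d)) (hq : IsParentArray d q) (hq' : IsParentArray d q')
    {r n n' : ℕ} (hr : r ≤ n) (hn : n < d) (hr' : r ≤ n') (hn' : n' < d)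
    (h : parentNode s q r n = parentNode s q' r n') : n = n' := by
  refine index_eq_of_image_labels_eq hs hq hq' hr hn hr' hn' ?_
  rw [← vars_parentNode, ← vars_parentNode, h]

lemma parentNode_ne_parent {d : ℕ} {s : ℕ → ℕ} {q : ℕ → ℕ → ℕ} (hs : Set.InjOn s (Set.Iio d))
    (hq : IsParentArray d q) {r n : ℕ} (hr : r < n) (hn : n < d) :
    parentNode s q r n ≠ parentNode s q r (q r n) := fun h => by
  have h1 := hq.lt r n hr hn
  have := index_eq_of_parentNode_eq hs hq hq hr.le hn (hq.le r n hr hn) (by omega) h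
  omega

lemma edgeSet_parentTree {d : ℕ} {s : ℕ → ℕ} {q : ℕ → ℕ → ℕ} (hs : Set.InjOn s (Set.Iio d))
    (hq : IsParentArray d q) (r : ℕ) : (parentTree d s q r).edgeSet =
      {e | ∃ n, r < n ∧ n < d ∧ e = s(parentNode s q r n, parentNode s q r (q r n))} := by
  rw [parentTree, SimpleGraph.edgeSet_fromEdgeSet, sdiff_eq_left, Set.disjoint_left]
  rintro _ ⟨n, hr, hn, rfl⟩ h
  exact parentNode_ne_parent hs hq hr hn (Sym2.mk_isDiag_iff.1 h)

lemma parentTree_adj {d : ℕ} {s : ℕ → ℕ} {q : ℕ → ℕ → ℕ} (hs : Set.InjOn s (Set.Iio d))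
    (hq : IsParentArray d q) {r : ℕ} {a b : VineNode r} : (parentTree d s q r).Adj a b ↔
      ∃ n, r < n ∧ n < d ∧ s(a, b) = s(parentNode s q r n, parentNode s q r (q r n)) := by
  rw [← SimpleGraph.mem_edgeSet, edgeSet_parentTree hs hq]
  rfl

lemma parentTree_adj_parent {d : ℕ} {s : ℕ → ℕ} {q : ℕ → ℕ → ℕ} (hs : Set.InjOn s (Set.Iio d))
    (hq : IsParentArray d q) {r n : ℕ} (hr : r < n) (hn : n < d) :
    (parentTree d s q r).Adj (parentNode s q r n) (parentNode s q r (q r n)) :=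
  (parentTree_adj hs hq).2 ⟨n, hr, hn, rfl⟩

lemma vineNodes_parentTree {d : ℕ} {s : ℕ → ℕ} {q : ℕ → ℕ → ℕ}
    (hs : Set.BijOn s (Set.Iio d) (Set.Icc 1 d)) (hq : IsParentArray d q) (r : ℕ) :
    vineNodes d (parentTree d s q) r = parentNode s q r '' Set.Ico r d := by
  cases r with
  | zero =>
    change Set.Icc 1 d = s '' _
    rw [← hs.image_eq]
    congr 1
    ext
    simp
  | succ r =>
    change (parentTree d s q r).edgeSet = _
    rw [edgeSet_parentTree hs.injOn hq]
    ext e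
    constructor
    · rintro ⟨n, h1, h2, rfl⟩
      exact ⟨n, ⟨h1, h2⟩, rfl⟩
    · rintro ⟨n, ⟨h1, h2⟩, rfl⟩
      exact ⟨n, h1, h2, rfl⟩

lemma isTree_parentTree {d : ℕ} {s : ℕ → ℕ} {q : ℕ → ℕ → ℕ} (hs : Set.InjOn s (Set.Iio d))
    (hq : IsParentArray d q) {r : ℕ} (hr : r < d) :
    ((parentTree d s q r).induce (parentNode s q r '' Set.Ico r d)).IsTree := by
  set N := parentNode s q r '' Set.Ico r d with hN
  have hmem : ∀ n, r ≤ n → n < d → parentNode s q r n ∈ N := fun n h1 h2 => ⟨n, ⟨h1, h2⟩, rfl⟩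
  have hfin : N.Finite := (Set.finite_Ico r d).image _
  have : Finite N := hfin
  have hcardN : Nat.card N = d - r := by
    rw [Nat.card_coe_set_eq, hN, Set.InjOn.ncard_image, Set.ncard_eq_toFinset_card']
    · simp
    · intro n h1 m h2 h
      exact index_eq_of_parentNode_eq hs hq hq h1.1 h1.2 h2.1 h2.2 h
  have hreach : ∀ n (h1 : r ≤ n) (h2 : n < d), ((parentTree d s q r).induce N).Reachable
      ⟨_, hmem n h1 h2⟩ ⟨_, hmem r le_rfl hr⟩ := by
    intro n
    induction n using Nat.strong_induction_on with
    | _ n ih =>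
      intro h1 h2
      rcases h1.eq_or_lt with rfl | h3
      · rfl
      · have hlt := hq.lt r n h3 h2
        refine SimpleGraph.Reachable.trans (SimpleGraph.Adj.reachable ?_)
          (ih (q r n) hlt (hq.le r n h3 h2) (by omega))
        exact parentTree_adj_parent hs hq h3 h2
  have hconn : ((parentTree d s q r).induce N).Connected := by
    rw [SimpleGraph.connected_iff_exists_forall_reachable]
    refine ⟨⟨_, hmem r le_rfl hr⟩, ?_⟩
    rintro ⟨_, n, ⟨h1, h2⟩, rfl⟩
    exact (hreach n h1 h2).symm
  refine SimpleGraph.isTree_iff_connected_and_card.2 ⟨hconn, le_antisymm ?_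
    hconn.card_vert_le_card_edgeSet_add_one⟩
  -- There are at most as many edges as there are nodes other than the root.
  have himg : (parentTree d s q r).edgeSet = parentNode s q (r + 1) '' Set.Ioo r d := by
    rw [edgeSet_parentTree hs hq]
    ext e
    constructor
    · rintro ⟨n, h1, h2, rfl⟩
      exact ⟨n, ⟨h1, h2⟩, rfl⟩
    · rintro ⟨n, ⟨h1, h2⟩, rfl⟩
      exact ⟨n, h1, h2, rfl⟩
  have hcardE : (parentTree d s q r).edgeSet.ncard ≤ d - r - 1 := by
    rw [himg]
    refine (Set.ncard_image_le (Set.finite_Ioo r d)).trans ?_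
    rw [Set.ncard_eq_toFinset_card']
    simp
  have : Finite (parentTree d s q r).edgeSet := by
    rw [himg]
    exact (Set.finite_Ioo r d).image _
  have := Nat.card_le_card_of_injective _
    (SimpleGraph.Embedding.mapEdgeSet
      (SimpleGraph.Embedding.induce (G := parentTree d s q r) N)).injective
  rw [Nat.card_coe_set_eq (parentTree d s q r).edgeSet] at this
  omega

/-- The regular vine with parent array `q` and variables `s 0, …, s (d - 1)`. -/
def parentVine {d : ℕ} {s : ℕ → ℕ} {q : ℕ → ℕ → ℕ}
    (hs : Set.BijOn s (Set.Iio d) (Set.Icc 1 d)) (hq : IsParentArray d q) : RegularVine d where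
  tree := parentTree d s q
  mem_nodes r a b h := by
    obtain ⟨n, hr, hn, h⟩ := (parentTree_adj hs.injOn hq).1 h
    have hlt := hq.lt r n hr hn
    have h1 : parentNode s q r n ∈ parentNode s q r '' Set.Ico r d := ⟨n, ⟨hr.le, hn⟩, rfl⟩
    have h2 : parentNode s q r (q r n) ∈ parentNode s q r '' Set.Ico r d :=
      ⟨q r n, ⟨hq.le r n hr hn, hlt.trans hn⟩, rfl⟩
    rw [vineNodes_parentTree hs hq]
    rcases Sym2.eq_iff.1 h with ⟨rfl, rfl⟩ | ⟨rfl, rfl⟩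
    · exact ⟨h1, h2⟩
    · exact ⟨h2, h1⟩
  isTree r h := by
    rw [vineNodes_parentTree hs hq]
    exact isTree_parentTree hs.injOn hq (by omega)
  tree_eq_bot r h := by
    ext a b
    rw [parentTree_adj hs.injOn hq]
    simp only [SimpleGraph.bot_adj, iff_false]
    rintro ⟨n, h1, h2, -⟩
    omega
  proximity r a b h := by
    obtain ⟨n, hr, hn, h⟩ := (parentTree_adj hs.injOn hq).1 h
    have h1 : parentNode s q r (q r n) ∈ (show Sym2 (VineNode r) from parentNode s q (r + 1) n) :=
      Sym2.mem_mk_right _ _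
    have h2 : parentNode s q r (q r n) ∈
        (show Sym2 (VineNode r) from parentNode s q (r + 1) (q (r + 1) n)) := by
      rcases hq.prox r n hr hn with h | h
      · rw [h]
        exact Sym2.mem_mk_left _ _
      · rw [h]
        exact Sym2.mem_mk_right _ _
    refine ⟨parentNode s q r (q r n), ?_⟩
    rcases Sym2.eq_iff.1 h with ⟨rfl, rfl⟩ | ⟨rfl, rfl⟩
    · exact ⟨h1, h2⟩
    · exact ⟨h2, h1⟩

/-- The vine determines its parent array. -/
lemma parentArray_eq_of_parentVine_eq {d : ℕ} {s : ℕ → ℕ} {q q' : ℕ → ℕ → ℕ}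
    (hs : Set.BijOn s (Set.Iio d) (Set.Icc 1 d)) (hq : IsParentArray d q)
    (hq' : IsParentArray d q') (h : parentVine hs hq = parentVine hs hq') {r n : ℕ} (hr : r < n)
    (hn : n < d) : q r n = q' r n := by
  have htree : parentTree d s q = parentTree d s q' := congrArg RegularVine.tree h
  -- The tree on a level gives the parents on it, and these the nodes of the next level.
  have step : ∀ r, (∀ n, r ≤ n → n < d → parentNode s q r n = parentNode s q' r n) →
      ∀ n, r < n → n < d → q r n = q' r n := by
    intro r hnode n hr hn
    have hadj := parentTree_adj_parent hs.injOn hq hr hn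
    rw [htree] at hadj
    obtain ⟨m, hr', hn', hm⟩ := (parentTree_adj hs.injOn hq').1 hadj
    obtain rfl : n = m :=
      index_eq_of_parentNode_eq (r := r + 1) hs.injOn hq hq' hr hn hr' hn' hm
    rw [hnode n hr.le hn, Sym2.congr_right] at hm
    have h1 := hq.lt r n hr hn
    have h2 := hq'.lt r n hr hn
    exact index_eq_of_parentNode_eq hs.injOn hq hq' (hq.le r n hr hn) (by omega)
      (hq'.le r n hr hn) (by omega) hm
  have hnode : ∀ r n, r ≤ n → n < d → parentNode s q r n = parentNode s q' r n := by
    intro r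
    induction r with
    | zero => exact fun _ _ _ => rfl
    | succ r ih =>
      intro n hr hn
      have h1 := hq.lt r n hr hn
      rw [parentNode, parentNode, ih n (by omega) hn,
        ih (q r n) (hq.le r n hr hn) (by omega), step r ih n hr hn]
  exact step r (hnode r) n hr hn

/-! ### A vine is determined by its pair-copulas -/

lemma RegularVine.eq_of_tree_eq {d : ℕ} {V W : RegularVine d} (h : V.tree = W.tree) : V = W := by
  cases V
  cases W
  cases h
  rfl

lemma pairCopulas_parentVine {d : ℕ} {s : ℕ → ℕ} {q : ℕ → ℕ → ℕ}
    (hs : Set.BijOn s (Set.Iio d) (Set.Icc 1 d)) (hq : IsParentArray d q) :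
    (parentVine hs hq).pairCopulas = {p | ∃ r n, r < n ∧ n < d ∧
      p = (symmDiff ((labels q r n).image s) ((labels q r (q r n)).image s),
        (labels q r n).image s ∩ (labels q r (q r n)).image s)} := by
  ext p
  constructor
  · rintro ⟨r, a, b, hab, rfl⟩
    obtain ⟨n, hr, hn, h⟩ := (parentTree_adj hs.injOn hq).1 hab
    refine ⟨r, n, hr, hn, ?_⟩
    rw [← vars_parentNode, ← vars_parentNode]
    rcases Sym2.eq_iff.1 h with ⟨rfl, rfl⟩ | ⟨rfl, rfl⟩
    · rfl
    · rw [symmDiff_comm, Finset.inter_comm]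
  · rintro ⟨r, n, hr, hn, rfl⟩
    refine ⟨r, _, _, parentTree_adj_parent hs.injOn hq hr hn, ?_⟩
    rw [vars_parentNode, vars_parentNode]

lemma card_image_labels {d : ℕ} {s : ℕ → ℕ} {q : ℕ → ℕ → ℕ} (hs : Set.InjOn s (Set.Iio d))
    (hq : IsParentArray d q) {r n : ℕ} (hr : r ≤ n) (hn : n < d) :
    ((labels q r n).image s).card = r + 1 := by
  rw [Finset.card_image_of_injOn, hq.card_labels hr hn]
  intro x hx y hy h
  have h1 := hq.le_of_mem_labels hr hn hx
  have h2 := hq.le_of_mem_labels hr hn hy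
  exact hs (Set.mem_Iio.2 (by omega)) (Set.mem_Iio.2 (by omega)) h

lemma card_symmDiff_add_two_mul_card_inter {α : Type*} [DecidableEq α] (A B : Finset α) :
    (symmDiff A B).card + 2 * (A ∩ B).card = A.card + B.card := by
  have h1 := Finset.card_sdiff_add_card_inter A B
  have h2 := Finset.card_sdiff_add_card_inter B A
  rw [Finset.inter_comm B A] at h2
  rw [symmDiff_def, Finset.sup_eq_union, Finset.card_union_of_disjoint disjoint_sdiff_sdiff]
  omega

lemma union_eq_symmDiff_union_inter {α : Type*} [DecidableEq α] (A B : Finset α) :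
    A ∪ B = symmDiff A B ∪ A ∩ B := by
  ext x
  simp only [Finset.mem_union, Finset.mem_symmDiff, Finset.mem_inter]
  tauto

/-- A pair of nodes with the pair-copula of an edge of the vine is that edge: the size of the
pair-copula gives the level, its largest label one node, and the symmetric difference the other. -/
lemma parentTree_adj_of_pairCopula_eq {d : ℕ} {s : ℕ → ℕ} {q : ℕ → ℕ → ℕ}
    (hs : Set.BijOn s (Set.Iio d) (Set.Icc 1 d)) (hq : IsParentArray d q) {r n m : ℕ}
    (hr : r ≤ m) (hmn : m < n) (hn : n < d)
    (h : (symmDiff ((labels q r n).image s) ((labels q r m).image s),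
      (labels q r n).image s ∩ (labels q r m).image s) ∈ (parentVine hs hq).pairCopulas) :
    (parentTree d s q r).Adj (parentNode s q r n) (parentNode s q r m) := by
  rw [pairCopulas_parentVine hs hq] at h
  obtain ⟨r', n', hr', hn', h⟩ := h
  obtain ⟨h1, h2⟩ := Prod.ext_iff.1 h
  dsimp only at h1 h2
  have hlt := hq.lt r' n' hr' hn'
  have hle := hq.le r' n' hr' hn'
  have hrr : r = r' := by
    have e1 := card_symmDiff_add_two_mul_card_inter ((labels q r n).image s)
      ((labels q r m).image s)
    have e2 := card_symmDiff_add_two_mul_card_inter ((labels q r' n').image s)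
      ((labels q r' (q r' n')).image s)
    rw [card_image_labels hs.injOn hq (by omega) hn,
      card_image_labels hs.injOn hq hr (by omega)] at e1
    rw [card_image_labels hs.injOn hq hr'.le hn',
      card_image_labels hs.injOn hq hle (by omega)] at e2
    rw [h1, h2] at e1
    omega
  subst hrr
  have hunion : (labels q r n).image s ∪ (labels q r m).image s =
      (labels q r n').image s ∪ (labels q r (q r n')).image s := by
    rw [union_eq_symmDiff_union_inter, h1, h2, ← union_eq_symmDiff_union_inter]
  have key : ∀ {n m n' m' : ℕ} (_ : r ≤ n) (_ : n < d) (_ : r ≤ n') (_ : r ≤ m')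
      (_ : n' < d) (_ : m' < n')
      (_ : (labels q r n).image s ∪ (labels q r m).image s =
        (labels q r n').image s ∪ (labels q r m').image s), n ≤ n' := by
    intro n m n' m' k1 k2 k3 k4 k5 k6 hu
    have hx := Finset.mem_union_left ((labels q r m).image s)
      (Finset.mem_image_of_mem s (mem_labels_self q r n))
    rw [hu, ← Finset.image_union] at hx
    obtain ⟨x, hx, hxn⟩ := Finset.mem_image.1 hx
    have hxle : x ≤ n' := by
      rcases Finset.mem_union.1 hx with hx | hx
      · exact hq.le_of_mem_labels k3 k5 hx
      · have := hq.le_of_mem_labels k4 (by omega) hx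
        omega
    have h3 : x = n := hs.injOn (Set.mem_Iio.2 (by omega)) k2 hxn
    omega
  obtain rfl : n = n' := le_antisymm (key (by omega) hn hr'.le hle hn' hlt hunion)
    (key hr'.le hn' (by omega) hr hn hmn hunion.symm)
  obtain rfl : m = q r n :=
    index_eq_of_image_labels_eq hs.injOn hq hq hr (by omega) hle (by omega)
      (symmDiff_right_injective _ h1)
  exact parentTree_adj_parent hs.injOn hq hr' hn

lemma RegularVine.eq_parentVine {d : ℕ} {s : ℕ → ℕ} {q : ℕ → ℕ → ℕ}
    (hs : Set.BijOn s (Set.Iio d) (Set.Icc 1 d)) (hq : IsParentArray d q) {V : RegularVine d}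
    (h : V.pairCopulas = (parentVine hs hq).pairCopulas) : V = parentVine hs hq := by
  have step : ∀ r, vineNodes d V.tree r = vineNodes d (parentTree d s q) r →
      V.tree r = parentTree d s q r := by
    intro r hnodes
    rcases Nat.lt_or_ge (r + 1) d with hd | hd
    swap
    · exact (V.tree_eq_bot r hd).trans ((parentVine hs hq).tree_eq_bot r hd).symm
    rw [vineNodes_parentTree hs hq] at hnodes
    have hle : V.tree r ≤ parentTree d s q r := by
      intro a b hab
      obtain ⟨ha, hb⟩ := V.mem_nodes r a b hab
      rw [hnodes] at ha hb
      obtain ⟨n, ⟨hn1, hn2⟩, rfl⟩ := ha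
      obtain ⟨m, ⟨hm1, hm2⟩, rfl⟩ := hb
      have hp : ∀ {n m : ℕ}, (V.tree r).Adj (parentNode s q r n) (parentNode s q r m) →
          (symmDiff ((labels q r n).image s) ((labels q r m).image s),
            (labels q r n).image s ∩ (labels q r m).image s) ∈
              (parentVine hs hq).pairCopulas := by
        intro n m hab
        rw [← h, ← vars_parentNode, ← vars_parentNode]
        exact ⟨r, _, _, hab, rfl⟩
      rcases lt_trichotomy m n with hmn | rfl | hmn
      · exact parentTree_adj_of_pairCopula_eq hs hq hm1 hmn hn2 (hp hab)
      · exact absurd rfl hab.ne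
      · exact (parentTree_adj_of_pairCopula_eq hs hq hn1 hmn hm2 (hp hab.symm)).symm
    -- Both graphs are trees on the same nodes, so one cannot be smaller than the other.
    have hV := V.isTree r hd
    rw [hnodes] at hV
    have hmin := (SimpleGraph.isTree_iff_minimal_connected.1
      (isTree_parentTree hs.injOn hq (r := r) (by omega))).2 hV.connected
        (fun a b hab => hle hab)
    refine le_antisymm hle fun a b hab => ?_
    obtain ⟨ha, hb⟩ := (parentVine hs hq).mem_nodes r a b hab
    change a ∈ vineNodes d (parentTree d s q) r at ha
    change b ∈ vineNodes d (parentTree d s q) r at hb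
    rw [vineNodes_parentTree hs hq] at ha hb
    exact hmin (show ((parentTree d s q r).induce _).Adj ⟨a, ha⟩ ⟨b, hb⟩ from hab)
  have hnodes : ∀ r, vineNodes d V.tree r = vineNodes d (parentTree d s q) r := by
    intro r
    induction r with
    | zero => rfl
    | succ r ih => exact congrArg SimpleGraph.edgeSet (step r ih)
  exact RegularVine.eq_of_tree_eq (funext fun r => step r (hnodes r))

/-! ### Columns of a matrix and label sets -/

lemma colFrom_eq_insert {d : ℕ} (M : Matrix (Fin d) (Fin d) ℕ) (k j : Fin d) :
    colFrom M k j = insert (M k j) (colBelow M k j) := by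
  rw [colFrom, colBelow, ← Finset.image_insert (fun r => M r j), Finset.Ioi_insert]

lemma colBelow_eq_colFrom {d : ℕ} (M : Matrix (Fin d) (Fin d) ℕ) {k l : Fin d} (j : Fin d)
    (h : (l : ℕ) = k + 1) : colBelow M k j = colFrom M l j := by
  have : Finset.Ioi k = Finset.Ici l := by
    ext x
    rw [Finset.mem_Ioi, Finset.mem_Ici, Fin.lt_def, Fin.le_def]
    omega
  rw [colBelow, colFrom, this]

lemma colBelow_eq_empty {d : ℕ} (M : Matrix (Fin d) (Fin d) ℕ) {k : Fin d} (j : Fin d)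
    (h : (k : ℕ) + 1 = d) : colBelow M k j = ∅ := by
  have : Finset.Ioi k = ∅ := by
    ext x
    simp only [Finset.mem_Ioi, Fin.lt_def, Finset.notMem_empty, iff_false]
    omega
  rw [colBelow, this, Finset.image_empty]

lemma card_colBelow_le {d : ℕ} (M : Matrix (Fin d) (Fin d) ℕ) (k j : Fin d) :
    (colBelow M k j).card ≤ k.rev := by
  refine Finset.card_image_le.trans ?_
  rw [Fin.card_Ioi, Fin.val_rev]
  omega

/-- The matrix `M` is linked to the parent array `q`: with rows and columns numbered backwards,
the entries of column `n` in the last `r + 1` rows are the variables of the parent `q r n`. -/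
def Linked {d : ℕ} (s : ℕ → ℕ) (q : ℕ → ℕ → ℕ) (M : Matrix (Fin d) (Fin d) ℕ)
    (k j : Fin d) : Prop :=
  colFrom M k j = (labels q k.rev (q k.rev j.rev)).image s

/-- The diagonal entry together with the last `r` entries of column `n` makes up the node `n` of
level `r`. -/
lemma insert_diag_colBelow {d : ℕ} {s : ℕ → ℕ} {q : ℕ → ℕ → ℕ} (hq : IsParentArray d q)
    {M : Matrix (Fin d) (Fin d) ℕ} (hdiag : ∀ i, M i i = s i.rev) {k j : Fin d} (hjk : j ≤ k)
    (hlink : ∀ l : Fin d, (l : ℕ) = k + 1 → Linked s q M l j) :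
    insert (M j j) (colBelow M k j) = (labels q k.rev j.rev).image s := by
  rw [Fin.le_def] at hjk
  have hj := j.isLt
  rcases Nat.lt_or_ge ((k : ℕ) + 1) d with hk | hk
  · have h1 : ((⟨k + 1, hk⟩ : Fin d).rev : ℕ) + 1 = k.rev := by
      rw [Fin.val_rev, Fin.val_rev]
      dsimp only
      omega
    rw [colBelow_eq_colFrom M j (l := ⟨k + 1, hk⟩) rfl, hlink ⟨k + 1, hk⟩ rfl, hdiag, ← h1,
      hq.labels_succ, Finset.image_insert]
    · rw [Fin.val_rev, Fin.val_rev]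
      dsimp only
      omega
    · exact j.rev.isLt
  · have hk' : (k : ℕ) + 1 = d := by omega
    have h1 : (k.rev : ℕ) = 0 := by
      rw [Fin.val_rev]
      omega
    rw [colBelow_eq_empty M j hk', h1, hdiag]
    rfl

lemma matrixPairCopulas_eq {d : ℕ} {s : ℕ → ℕ} {q : ℕ → ℕ → ℕ}
    (hs : Set.BijOn s (Set.Iio d) (Set.Icc 1 d)) (hq : IsParentArray d q)
    {M : Matrix (Fin d) (Fin d) ℕ} (hdiag : ∀ i, M i i = s i.rev)
    (hlink : ∀ j k, j < k → Linked s q M k j) :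
    matrixPairCopulas M = (parentVine hs hq).pairCopulas := by
  have key : ∀ j k : Fin d, j < k → ({M k j, M j j}, colBelow M k j) =
      (symmDiff ((labels q k.rev j.rev).image s)
        ((labels q k.rev (q k.rev j.rev)).image s),
       (labels q k.rev j.rev).image s ∩ (labels q k.rev (q k.rev j.rev)).image s) := by
    intro j k hjk
    have hlt : (k.rev : ℕ) < j.rev := Fin.lt_def.1 (Fin.rev_lt_rev.2 hjk)
    have hjd := j.rev.isLt
    have hX := insert_diag_colBelow hq hdiag hjk.le
      fun l hl => hlink j l (Fin.lt_def.2 (by rw [Fin.lt_def] at hjk; omega))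
    have hY : insert (M k j) (colBelow M k j) = _ := (colFrom_eq_insert M k j).symm.trans
      (hlink j k hjk)
    have hcard := card_colBelow_le M k j
    have hp := hq.lt _ _ hlt hjd
    have hX1 : M j j ∉ colBelow M k j := fun h => by
      have := card_image_labels hs.injOn hq hlt.le hjd
      rw [← hX, Finset.insert_eq_of_mem h] at this
      omega
    have hY1 : M k j ∉ colBelow M k j := fun h => by
      have := card_image_labels hs.injOn hq (hq.le _ _ hlt hjd) (hp.trans hjd)
      rw [← hY, Finset.insert_eq_of_mem h] at this
      omega
    have hne : M k j ≠ M j j := fun h => by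
      have h1 : s j.rev ∈ (labels q k.rev (q k.rev j.rev)).image s := by
        rw [← hY, ← hdiag, h]
        exact Finset.mem_insert_self _ _
      obtain ⟨x, hx, hxj⟩ := Finset.mem_image.1 h1
      have h2 := hq.le_of_mem_labels (hq.le _ _ hlt hjd) (hp.trans hjd) hx
      have h3 : x = j.rev := hs.injOn (Set.mem_Iio.2 (by omega)) hjd hxj
      omega
    rw [← hX, ← hY, Prod.ext_iff]
    constructor
    · ext x
      simp only [Finset.mem_insert, Finset.mem_singleton, Finset.mem_symmDiff]
      grind
    · ext x
      simp only [Finset.mem_insert, Finset.mem_inter]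
      grind
  rw [pairCopulas_parentVine hs hq]
  ext p
  constructor
  · rintro ⟨j, k, hjk, rfl⟩
    exact ⟨k.rev, j.rev, Fin.lt_def.1 (Fin.rev_lt_rev.2 hjk), j.rev.isLt, key j k hjk⟩
  · rintro ⟨r, n, hr, hn, rfl⟩
    refine ⟨Fin.rev ⟨n, hn⟩, Fin.rev ⟨r, hr.trans hn⟩, Fin.rev_lt_rev.2 (Fin.lt_def.2 hr), ?_⟩
    rw [key _ _ (Fin.rev_lt_rev.2 (Fin.lt_def.2 hr)), Fin.rev_rev, Fin.rev_rev]

/-! ### A structure matrix of a given vine -/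

/-- The index of the variable that the column of `n` has in row `r`, counted from the bottom. -/
def columnIndex (q : ℕ → ℕ → ℕ) : ℕ → ℕ → ℕ
  | 0, n => q 0 n
  | r + 1, n => if q r n = q (r + 1) n then columnIndex q r (q (r + 1) n) else q (r + 1) n

lemma IsParentArray.image_columnIndex {d : ℕ} {q : ℕ → ℕ → ℕ} (hq : IsParentArray d q) {r n : ℕ}
    (hr : r < n) (hn : n < d) :
    (Finset.range (r + 1)).image (columnIndex q · n) = labels q r (q r n) := by
  suffices h : (∀ n, r ≤ n → n < d →
      labels q r n = insert n ((Finset.range r).image (columnIndex q · n))) ∧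
      ∀ n, r < n → n < d →
        (Finset.range (r + 1)).image (columnIndex q · n) = labels q r (q r n) from h.2 n hr hn
  clear hr hn n
  induction r with
  | zero => exact ⟨fun _ _ _ => rfl, fun _ _ _ => rfl⟩
  | succ r ih =>
    refine ⟨fun n hr hn => by rw [hq.labels_succ hr hn, ih.2 n hr hn], fun n hr hn => ?_⟩
    have hle := hq.le (r + 1) n hr hn
    have hlt := hq.lt (r + 1) n hr hn
    rw [Finset.range_add_one, Finset.image_insert, ih.2 n (by omega) hn, columnIndex,
      hq.labels_succ hle (by omega)]
    split_ifs with h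
    · rw [h, ih.1 (q (r + 1) n) (by omega) (by omega), ← ih.2 _ hle (by omega),
        Finset.insert_comm, Finset.range_add_one (n := r), Finset.image_insert]
    · rw [(hq.prox r n hr hn).resolve_left h]

/-- The structure matrix with diagonal `s (d - 1), …, s 0` of the vine with parent array `q`. -/
def parentMatrix (d : ℕ) (s : ℕ → ℕ) (q : ℕ → ℕ → ℕ) : Matrix (Fin d) (Fin d) ℕ := fun k j =>
  if j < k then s (columnIndex q k.rev j.rev) else if j = k then s j.rev else 0

lemma parentMatrix_diag (d : ℕ) (s : ℕ → ℕ) (q : ℕ → ℕ → ℕ) (i : Fin d) :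
    parentMatrix d s q i i = s i.rev := by
  simp [parentMatrix]

lemma parentMatrix_below {d : ℕ} (s : ℕ → ℕ) (q : ℕ → ℕ → ℕ) {j k : Fin d} (h : j < k) :
    parentMatrix d s q k j = s (columnIndex q k.rev j.rev) := by
  simp [parentMatrix, h]

lemma linked_parentMatrix {d : ℕ} (s : ℕ → ℕ) {q : ℕ → ℕ → ℕ} (hq : IsParentArray d q)
    {j k : Fin d} (h : j < k) : Linked s q (parentMatrix d s q) k j := by
  have hlt : (k.rev : ℕ) < j.rev := Fin.lt_def.1 (Fin.rev_lt_rev.2 h)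
  rw [Linked, ← hq.image_columnIndex hlt j.rev.isLt, colFrom, Finset.image_image]
  ext x
  simp only [Finset.mem_image, Finset.mem_Ici, Finset.mem_range, Function.comp]
  constructor
  · rintro ⟨i, hi, rfl⟩
    refine ⟨i.rev, ?_, (parentMatrix_below s q (h.trans_le hi)).symm⟩
    have := Fin.le_def.1 (Fin.rev_le_rev.2 hi)
    omega
  · rintro ⟨r, hr, rfl⟩
    have hrd : r < d := by
      have := k.rev.isLt
      omega
    have hk : k ≤ Fin.rev ⟨r, hrd⟩ := by
      rw [← Fin.rev_le_rev, Fin.rev_rev, Fin.le_def]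
      exact Nat.le_of_lt_succ hr
    refine ⟨Fin.rev ⟨r, hrd⟩, hk, ?_⟩
    rw [parentMatrix_below s q (h.trans_le hk), Fin.rev_rev]

lemma colFrom_diag_parentMatrix {d : ℕ} (s : ℕ → ℕ) {q : ℕ → ℕ → ℕ} (hq : IsParentArray d q)
    (j : Fin d) :
    colFrom (parentMatrix d s q) j j = (Finset.range (j.rev + 1)).image s := by
  rw [colFrom_eq_insert, insert_diag_colBelow hq (parentMatrix_diag d s q) le_rfl
    fun l hl => linked_parentMatrix s hq (Fin.lt_def.2 (by omega)), hq.labels_diag j.rev.isLt]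

lemma isVineStructureMatrix_parentMatrix {d : ℕ} {s : ℕ → ℕ} {q : ℕ → ℕ → ℕ}
    (hs : Set.BijOn s (Set.Iio d) (Set.Icc 1 d)) (hq : IsParentArray d q) :
    IsVineStructureMatrix (parentMatrix d s q) where
  upper_eq_zero i j h := by
    simp only [parentMatrix, if_neg h.not_gt, if_neg h.ne']
  lower_mem i j h := by
    have h1 : parentMatrix d s q i j ∈ colFrom (parentMatrix d s q) j j :=
      Finset.mem_image_of_mem _ (Finset.mem_Ici.2 h)
    rw [colFrom_diag_parentMatrix s hq] at h1
    obtain ⟨n, hn, h2⟩ := Finset.mem_image.1 h1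
    rw [← h2]
    refine hs.mapsTo (Set.mem_Iio.2 ?_)
    have := Finset.mem_range.1 hn
    have := j.rev.isLt
    omega
  col_subset i j h := by
    rw [colFrom_diag_parentMatrix s hq, colFrom_diag_parentMatrix s hq]
    have := Fin.lt_def.1 (Fin.rev_lt_rev.2 h)
    exact Finset.image_subset_image (Finset.range_subset_range.2 (by omega))
  diag_notMem i j h h1 := by
    rw [colFrom_diag_parentMatrix s hq, parentMatrix_diag] at h1
    obtain ⟨n, hn, h2⟩ := Finset.mem_image.1 h1
    have h3 : (j.rev : ℕ) < i.rev := Fin.lt_def.1 (Fin.rev_lt_rev.2 (Fin.lt_def.2 (by omega)))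
    have h4 := Finset.mem_range.1 hn
    have h5 := i.rev.isLt
    have := hs.injOn (Set.mem_Iio.2 (by omega)) (Set.mem_Iio.2 h5) h2
    omega
  exists_col i k _ hik := by
    have hlt : (k.rev : ℕ) < i.rev := Fin.lt_def.1 (Fin.rev_lt_rev.2 hik)
    have hid := i.rev.isLt
    have hp := hq.lt _ _ hlt hid
    have hp' := hq.le _ _ hlt hid
    -- The column of the parent has the required entries.
    obtain ⟨j, hj⟩ : ∃ j : Fin d, (j.rev : ℕ) = q k.rev i.rev :=
      ⟨Fin.rev ⟨q k.rev i.rev, by omega⟩, by rw [Fin.rev_rev]⟩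
    have hij : i < j := Fin.rev_lt_rev.1 (Fin.lt_def.2 (by omega))
    have hjk : j ≤ k := Fin.rev_le_rev.1 (Fin.le_def.2 (by omega))
    refine ⟨j, hij, ?_⟩
    rw [parentMatrix_below s q hik, parentMatrix_diag]
    rcases Nat.lt_or_ge ((k : ℕ) + 1) d with hk | hk
    · obtain ⟨l, hl⟩ : ∃ l : Fin d, (l : ℕ) = k + 1 := ⟨⟨k + 1, hk⟩, rfl⟩
      have hkl : k < l := Fin.lt_def.2 (by omega)
      have hr : (k.rev : ℕ) = l.rev + 1 := by
        rw [Fin.val_rev, Fin.val_rev]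
        omega
      rw [colBelow_eq_colFrom _ i hl, linked_parentMatrix s hq (hik.trans hkl), hr, columnIndex,
        ← hr, ← hj]
      split_ifs with h
      · refine Or.inr ⟨l, hl, parentMatrix_below s q (hjk.trans_lt hkl) |>.symm, ?_⟩
        rw [← parentMatrix_diag d s q j, h, insert_diag_colBelow hq (parentMatrix_diag d s q)
          (hjk.trans hkl.le)]
        intro m hm
        exact linked_parentMatrix s hq (Fin.lt_def.2 (by
          rw [Fin.le_def] at hjk
          omega))
      · refine Or.inl ⟨rfl, ?_⟩
        rw [colBelow_eq_colFrom _ j hl, linked_parentMatrix s hq (hjk.trans_lt hkl), hj, hr,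
          ← (hq.prox _ _ (by omega) hid).resolve_left]
        rwa [← hr, ← hj]
    · have hk' : (k : ℕ) + 1 = d := by omega
      have hr : (k.rev : ℕ) = 0 := by
        rw [Fin.val_rev]
        omega
      refine Or.inl ⟨?_, ?_⟩
      · rw [hj, hr]
        rfl
      · rw [colBelow_eq_empty _ _ hk', colBelow_eq_empty _ _ hk']

/-! ### The parent array of a structure matrix -/

lemma IsVineStructureMatrix.diag_notMem_of_lt {d : ℕ} {M : Matrix (Fin d) (Fin d) ℕ}
    (hM : IsVineStructureMatrix M) {i j : Fin d}
    (h : i < j) : M i i ∉ colFrom M j j := by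
  have hj := j.isLt
  rw [Fin.lt_def] at h
  have h1 := hM.diag_notMem i ⟨i + 1, by omega⟩ rfl
  rcases Nat.lt_or_ge ((i : ℕ) + 1) j with h2 | h2
  · exact fun h3 => h1 (hM.col_subset _ j (Fin.lt_def.2 h2) h3)
  · have : j = ⟨i + 1, by omega⟩ := Fin.ext (by dsimp only; omega)
    rwa [this]

lemma IsVineStructureMatrix.diag_mem {d : ℕ} {M : Matrix (Fin d) (Fin d) ℕ}
    (hM : IsVineStructureMatrix M) {i j : Fin d} (h : i ≤ j) :
    M j j ∈ colFrom M i i := by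
  have h1 : M j j ∈ colFrom M j j := Finset.mem_image_of_mem _ (Finset.mem_Ici.2 le_rfl)
  rcases h.eq_or_lt with rfl | h
  · exact h1
  · exact hM.col_subset i j h h1

/-- The entries of a column are distinct, as the column holds all later diagonal entries. -/
lemma IsVineStructureMatrix.injOn_col {d : ℕ} {M : Matrix (Fin d) (Fin d) ℕ}
    (hM : IsVineStructureMatrix M) (i : Fin d) :
    Set.InjOn (fun r => M r i) (Finset.Ici i : Finset (Fin d)) := by
  have hinj : Set.InjOn (fun r => M r r) (Finset.Ici i : Finset (Fin d)) := by
    have key : ∀ a b : Fin d, a < b → M a a ≠ M b b := fun a b hab h => by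
      refine hM.diag_notMem_of_lt hab ?_
      rw [h]
      exact hM.diag_mem le_rfl
    intro a _ b _ h
    rcases lt_trichotomy a b with hab | rfl | hab
    · exact absurd h (key a b hab)
    · rfl
    · exact absurd h.symm (key b a hab)
  refine Finset.card_image_iff.1 (le_antisymm Finset.card_image_le ?_)
  rw [← Finset.card_image_of_injOn hinj]
  refine Finset.card_le_card fun x hx => ?_
  obtain ⟨j, hj, rfl⟩ := Finset.mem_image.1 hx
  exact hM.diag_mem (Finset.mem_Ici.1 hj)

lemma IsVineStructureMatrix.notMem_colBelow {d : ℕ} {M : Matrix (Fin d) (Fin d) ℕ}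
    (hM : IsVineStructureMatrix M) {i k : Fin d}
    (h : i ≤ k) : M k i ∉ colBelow M k i := fun h1 => by
  obtain ⟨l, hl, h2⟩ := Finset.mem_image.1 h1
  have hl := Finset.mem_Ioi.1 hl
  have := hM.injOn_col i (Finset.mem_coe.2 (Finset.mem_Ici.2 (h.trans hl.le)))
    (Finset.mem_coe.2 (Finset.mem_Ici.2 h)) h2
  exact hl.ne' this

lemma colBelow_subset_colFrom {d : ℕ} (M : Matrix (Fin d) (Fin d) ℕ) {i k : Fin d} (h : i ≤ k) :
    colBelow M k i ⊆ colFrom M i i :=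
  Finset.image_subset_image fun _ hx =>
    Finset.mem_Ici.2 (h.trans (Finset.mem_Ioi.1 hx).le)

/-- A node is determined, among those of its level, by its set of variables. -/
lemma IsVineStructureMatrix.column_unique {d : ℕ} {M : Matrix (Fin d) (Fin d) ℕ}
    (hM : IsVineStructureMatrix M) {i j k : Fin d}
    (hi : i ≤ k) (hj : j ≤ k)
    (h : insert (M i i) (colBelow M k i) = insert (M j j) (colBelow M k j)) : i = j := by
  have key : ∀ i j : Fin d, j ≤ k →
      insert (M i i) (colBelow M k i) = insert (M j j) (colBelow M k j) → ¬ i < j := by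
    intro i j hj h hij
    refine hM.diag_notMem_of_lt hij ?_
    have h1 : M i i ∈ insert (M j j) (colBelow M k j) := by
      rw [← h]
      exact Finset.mem_insert_self _ _
    rcases Finset.mem_insert.1 h1 with h1 | h1
    · rw [h1]
      exact hM.diag_mem le_rfl
    · exact colBelow_subset_colFrom M hj h1
  exact le_antisymm (not_lt.1 (key j i hi h.symm)) (not_lt.1 (key i j hj h))

/-- The last entries of a column form a node of a later column, and the same entries without the
first form one of the two nodes joined by it. The bound `j ≤ k` holds because the entries above the
diagonal vanish. -/
lemma IsVineStructureMatrix.exists_parent {d : ℕ} {M : Matrix (Fin d) (Fin d) ℕ}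
    (hM : IsVineStructureMatrix M) {i k : Fin d}
    (hik : i < k) : ∃ j, i < j ∧ j ≤ k ∧
      colFrom M k i = insert (M j j) (colBelow M k j) ∧
      ∀ l : Fin d, (l : ℕ) = k + 1 → colFrom M l i = colFrom M l j ∨
        colFrom M l i = insert (M j j) (colBelow M l j) := by
  rcases Nat.lt_or_ge ((i : ℕ) + 2) d with hi | hi
  · obtain ⟨j, hij, hj⟩ := hM.exists_col i k hi hik
    have hnot := hM.notMem_colBelow hik.le
    have hzero : 0 ∉ colBelow M k i := fun h => by
      obtain ⟨r, hr, h0⟩ := Finset.mem_image.1 h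
      have := (hM.lower_mem r i (hik.le.trans (Finset.mem_Ioi.1 hr).le)).1
      omega
    have hpos := (hM.lower_mem k i hik.le).1
    have hjk : j ≤ k := by
      by_contra hkj
      rw [not_le] at hkj
      rcases hj with ⟨h1, h2⟩ | ⟨l, hl, h1, h2⟩
      · have h3 : ∀ l, k < l → M l j ∈ colBelow M k j := fun l hl =>
          Finset.mem_image_of_mem _ (Finset.mem_Ioi.2 hl)
        rw [← h2] at h3
        exact hnot (h1 ▸ h3 j hkj)
      · have hlj : l ≤ j := by
          rw [Fin.lt_def] at hkj
          rw [Fin.le_def]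
          omega
        rcases hlj.eq_or_lt with rfl | hlj
        · rw [h2, h1] at hnot
          exact hnot (Finset.mem_insert_self _ _)
        · rw [h1, hM.upper_eq_zero l j hlj] at hpos
          omega
    refine ⟨j, hij, hjk, ?_, fun l hl => ?_⟩
    · rw [colFrom_eq_insert]
      rcases hj with ⟨h1, h2⟩ | ⟨l, hl, h1, h2⟩
      · rw [h1, h2]
      · rw [h1, h2, Finset.insert_comm, colBelow_eq_colFrom M j hl, colFrom_eq_insert]
    · rcases hj with ⟨-, h2⟩ | ⟨l', hl', -, h2⟩
      · rw [colBelow_eq_colFrom M i hl, colBelow_eq_colFrom M j hl] at h2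
        exact Or.inl h2
      · obtain rfl : l = l' := Fin.ext (hl.trans hl'.symm)
        rw [colBelow_eq_colFrom M i hl] at h2
        exact Or.inr h2
  · -- The last two columns are not subject to `exists_col`.
    rw [Fin.lt_def] at hik
    have hk := k.isLt
    refine ⟨k, Fin.lt_def.2 hik, le_rfl, ?_, fun l hl => absurd l.isLt (by omega)⟩
    have hdiag : M k k ≠ M i i := fun h => hM.diag_notMem i k (by omega) (by
      rw [← h]
      exact hM.diag_mem le_rfl)
    have hmem := hM.diag_mem (Fin.lt_def.2 hik).le
    rw [colFrom_eq_insert, colBelow_eq_colFrom M i (k := i) (l := k) (by omega),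
      colFrom_eq_insert, colBelow_eq_empty M i (by omega)] at hmem
    rw [colFrom_eq_insert, colBelow_eq_empty M i (by omega), colBelow_eq_empty M k (by omega)]
    rcases Finset.mem_insert.1 hmem with h | h
    · exact absurd h hdiag
    · have h' : M k k = M k i := by simpa using h
      rw [h']

/-- The parents in the columns of a structure matrix form a parent array. -/
lemma IsVineStructureMatrix.exists_parentArray {d : ℕ} {M : Matrix (Fin d) (Fin d) ℕ}
    (hM : IsVineStructureMatrix M) :
    ∃ q, IsParentArray d q ∧ ∀ i k : Fin d, i < k → ∃ j, i < j ∧ j ≤ k ∧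
      q k.rev i.rev = j.rev ∧ colFrom M k i = insert (M j j) (colBelow M k j) := by
  choose! f hf1 hf2 hf3 hf4 using fun i k : Fin d => hM.exists_parent (i := i) (k := k)
  let q : ℕ → ℕ → ℕ := fun r n =>
    if h : r < d ∧ n < d then (f (Fin.rev ⟨n, h.2⟩) (Fin.rev ⟨r, h.1⟩)).rev else 0
  have hqf : ∀ i k : Fin d, q k.rev i.rev = (f i k).rev := fun i k => by
    have : (k.rev : ℕ) < d ∧ (i.rev : ℕ) < d := ⟨k.rev.isLt, i.rev.isLt⟩
    simp only [q, dif_pos this, Fin.eta, Fin.rev_rev]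
  have hidx : ∀ n, n < d → ∃ i : Fin d, n = i.rev := fun n hn =>
    ⟨Fin.rev ⟨n, hn⟩, by rw [Fin.rev_rev]⟩
  refine ⟨q, ⟨fun r n hr hn => ?_, fun r n hr hn => ?_, fun r n hr hn => ?_⟩,
    fun i k hik => ⟨f i k, hf1 i k hik, hf2 i k hik, hqf i k, hf3 i k hik⟩⟩
  · obtain ⟨k, rfl⟩ := hidx r (by omega)
    obtain ⟨i, rfl⟩ := hidx n hn
    rw [hqf]
    exact Fin.le_def.1 (Fin.rev_le_rev.2 (hf2 i k (Fin.rev_lt_rev.1 (Fin.lt_def.2 hr))))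
  · obtain ⟨k, rfl⟩ := hidx r (by omega)
    obtain ⟨i, rfl⟩ := hidx n hn
    rw [hqf]
    exact Fin.lt_def.1 (Fin.rev_lt_rev.2 (hf1 i k (Fin.rev_lt_rev.1 (Fin.lt_def.2 hr))))
  · obtain ⟨l, rfl⟩ := hidx r (by omega)
    obtain ⟨k, hk⟩ := hidx (l.rev + 1) (by omega)
    obtain ⟨i, rfl⟩ := hidx n hn
    have hl : (l : ℕ) = k + 1 := by
      rw [Fin.val_rev, Fin.val_rev] at hk
      have := l.isLt
      have := k.isLt
      omega
    have hkl : k < l := Fin.lt_def.2 (by omega)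
    have hik : i < k := Fin.rev_lt_rev.1 (Fin.lt_def.2 (by omega))
    rw [hk, hqf, hqf, hqf]
    have hj := hf2 i k hik
    have hil := hf3 i l (hik.trans hkl)
    rcases hf4 i k hik l hl with h | h
    · rw [hil, hf3 _ l (hj.trans_lt hkl)] at h
      rw [hM.column_unique (hf2 i l (hik.trans hkl)) (hf2 _ l (hj.trans_lt hkl)) h]
      exact Or.inr rfl
    · rw [hil] at h
      rw [hM.column_unique (hf2 i l (hik.trans hkl)) (hj.trans hkl.le) h]
      exact Or.inl rfl

lemma linked_of_parents {d : ℕ} {M : Matrix (Fin d) (Fin d) ℕ} {s : ℕ → ℕ} {q : ℕ → ℕ → ℕ}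
    (hq : IsParentArray d q) (hdiag : ∀ i, M i i = s i.rev)
    (h : ∀ i k : Fin d, i < k → ∃ j, i < j ∧ j ≤ k ∧
      q k.rev i.rev = j.rev ∧ colFrom M k i = insert (M j j) (colBelow M k j)) :
    ∀ i k, i < k → Linked s q M k i := by
  have key : ∀ r, ∀ i k : Fin d, (k.rev : ℕ) = r → i < k → Linked s q M k i := by
    intro r
    induction r with
    | zero =>
      intro i k hk hik
      obtain ⟨j, -, hjk, h1, h2⟩ := h i k hik
      rw [Linked, h1, h2, insert_diag_colBelow hq hdiag hjk]
      intro l hl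
      rw [Fin.val_rev] at hk
      exact absurd l.isLt (by omega)
    | succ r ih =>
      intro i k hk hik
      obtain ⟨j, -, hjk, h1, h2⟩ := h i k hik
      rw [Linked, h1, h2, insert_diag_colBelow hq hdiag hjk]
      intro l hl
      refine ih j l ?_ (Fin.lt_def.2 (by rw [Fin.le_def] at hjk; omega))
      rw [Fin.val_rev] at hk ⊢
      omega
  exact fun i k => key _ i k rfl

/-! ### Counting -/

theorem proposition4 (d : ℕ) (hd : 2 ≤ d) (σ : Fin d ≃ Finset.Icc 1 d) :
    Set.ncard {V : RegularVine d | ∃ M : Matrix (Fin d) (Fin d) ℕ,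
      V.HasStructureMatrix M ∧ ∀ i, M i i = (σ i : ℕ)} =
    2 ^ ((d - 2).choose 2 + (d - 2)) := by
  let s : ℕ → ℕ := fun n => if h : n < d then σ (Fin.rev ⟨n, h⟩) else 0
  have hsσ : ∀ i : Fin d, s i.rev = σ i := fun i => by
    simp only [s, dif_pos i.rev.isLt, Fin.eta, Fin.rev_rev]
  have hs : Set.BijOn s (Set.Iio d) (Set.Icc 1 d) := by
    have hidx : ∀ n ∈ Set.Iio d, ∃ i : Fin d, n = i.rev := fun n hn =>
      ⟨Fin.rev ⟨n, hn⟩, by rw [Fin.rev_rev]⟩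
    refine ⟨fun n hn => ?_, fun n hn m hm h => ?_, fun v hv => ?_⟩
    · obtain ⟨i, rfl⟩ := hidx n hn
      rw [hsσ]
      exact Finset.mem_Icc.1 (σ i).2
    · obtain ⟨i, rfl⟩ := hidx n hn
      obtain ⟨j, rfl⟩ := hidx m hm
      rw [hsσ, hsσ] at h
      rw [σ.injective (Subtype.ext h)]
    · refine ⟨(σ.symm ⟨v, Finset.mem_Icc.2 hv⟩).rev, Fin.isLt _, ?_⟩
      rw [hsσ, Equiv.apply_symm_apply]
  have himage : {V : RegularVine d | ∃ M : Matrix (Fin d) (Fin d) ℕ,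
      V.HasStructureMatrix M ∧ ∀ i, M i i = (σ i : ℕ)} =
      (fun S => parentVine hs (isParentArray_choiceArray d S)) ''
        ((choicePositions d).powerset : Set (Finset (Σ _ : ℕ, ℕ))) := by
    ext V
    constructor
    · rintro ⟨M, ⟨hM, hMV⟩, hdiag⟩
      obtain ⟨q, hq, hqM⟩ := hM.exists_parentArray
      obtain ⟨S, hS, hSq⟩ := hq.exists_choiceArray
      refine ⟨S, Finset.mem_coe.2 (Finset.mem_powerset.2 hS), ?_⟩
      have hdiag' : ∀ i, M i i = s i.rev := fun i => (hdiag i).trans (hsσ i).symm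
      have hlink := linked_of_parents (isParentArray_choiceArray d S) hdiag'
        fun i k hik => by
          rw [hSq _ _ (Fin.lt_def.1 (Fin.rev_lt_rev.2 hik)) i.rev.isLt]
          exact hqM i k hik
      exact (RegularVine.eq_parentVine hs _
        (hMV.symm.trans (matrixPairCopulas_eq hs _ hdiag' hlink))).symm
    · rintro ⟨S, -, rfl⟩
      have hq := isParentArray_choiceArray d S
      refine ⟨parentMatrix d s (choiceArray S), ⟨isVineStructureMatrix_parentMatrix hs hq,
        matrixPairCopulas_eq hs hq (parentMatrix_diag d s _)
          fun j k h => linked_parentMatrix s hq h⟩, fun i => ?_⟩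
      rw [parentMatrix_diag, hsσ]
  rw [himage, Set.InjOn.ncard_image, Set.ncard_coe_finset, Finset.card_powerset,
    card_choicePositions hd]
  intro S hS T hT h
  have hST : ∀ r n, r < n → n < d → choiceArray S r n = choiceArray T r n := fun r n hr hn =>
    parentArray_eq_of_parentVine_eq hs _ _ h hr hn
  have hS := Finset.mem_powerset.1 (Finset.mem_coe.1 hS)
  have hT := Finset.mem_powerset.1 (Finset.mem_coe.1 hT)
  ext ⟨n, r⟩
  by_cases hx : (⟨n, r⟩ : Σ _ : ℕ, ℕ) ∈ choicePositions d
  · obtain ⟨h1, h2⟩ := mem_choicePositions.1 hx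
    rw [mem_iff_choiceArray_eq S r n h1, mem_iff_choiceArray_eq T r n h1,
      hST r n (by omega) h2, hST (r + 1) n h1 h2]
  · exact ⟨fun h => absurd (hS h) hx, fun h => absurd (hT h) hx⟩
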